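/- Let $m,n\ge 1$ and $r\ge 0$ be integers with $\gcd(m,n)=\gcd(m,r-1)=1$ and $r^n\equiv 1 \pmod m$, and let $ZM(m,n,r)$ be the group with presentation $$ZM(m,n,r)=\langle a,b \mid a^m=b^n=1,\ b^{-1}ab=a^r\rangle .$$ For a finite group $G$, let $CF_2(G)$ denote the number of ordered pairs $(H,K)$ of cyclic subgroups of $G$ such that $HK=G$, and write $(x,y)$ for the greatest common divisor of $x$ and $y$. Then $$CF_2(ZM(m,n,r))=\sum_{\substack{m_2,m_3\mid m \\ n_2,n_3\mid n \\ (m_2,m_3)=1 \\ (n_2,n_3)=1 \\ \frac{m}{m_2}\mid r^{n_2}-1,\ \frac{m}{m_3}\mid r^{n_3}-1}}\left(m_2,\frac{r^n-1}{r^{n_2}-1}\right)\left(m_3,\frac{r^n-1}{r^{n_3}-1}\right),$$ where the sum runs over positive divisors. (If $r=1$, then $m=1$, so $m_2=m_3=1$ and each greatest common divisor in the summand is understood to be $1$.) In particular, $CF_2(ZM(9,4,8))=36$. -/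

import Mathlib

open scoped Pointwise

/-- The two generators of a ZM-group. -/
inductive ZMGenerator : Type
  | a : ZMGenerator
  | b : ZMGenerator

/-- The relators of `⟨a, b ∣ a ^ m = b ^ n = 1, b⁻¹ a b = a ^ r⟩`. -/
def zmRelators (m n r : ℕ) : Set (FreeGroup ZMGenerator) :=
  let a := FreeGroup.of ZMGenerator.a
  let b := FreeGroup.of ZMGenerator.b
  {a ^ m, b ^ n, b⁻¹ * a * b * (a ^ r)⁻¹}

/-- The group `ZM(m, n, r)`, given by generators and relations. -/
abbrev ZM (m n r : ℕ) : Type := PresentedGroup (zmRelators m n r)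

/-- The set of cyclic factorizations of `G`: ordered pairs `(H, K)` of cyclic subgroups of `G`
whose product set `HK = {hk ∣ h ∈ H, k ∈ K}` is all of `G`. -/
def cyclicFactorizations (G : Type*) [Group G] : Set (Subgroup G × Subgroup G) :=
  {p | IsCyclic p.1 ∧ IsCyclic p.2 ∧ (p.1 : Set G) * (p.2 : Set G) = Set.univ}

/-- The cyclic factorization number `CF₂(G)` of a finite group `G`. -/
noncomputable def CF₂ (G : Type*) [Group G] : ℕ := (cyclicFactorizations G).ncard

/-! ### Product sets and coset orbits. -/

section ProductSets

variable {G : Type*} [Group G]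

/-! The group `G` has order `m * n` with `m`, `n` coprime. It is an extension of a cyclic group of
order `n` by `⟨a⟩`, and `b` splits it.

Two facts give the formula. First, `HK = G` exactly when the indices of `H` and `K` are coprime
(`mul_eq_univ_iff`), so only the number of cyclic subgroups of each index matters. Second, an index
is uniquely `d * e` with `d ∣ m`, `e ∣ n`, and a cyclic subgroup of that index is `⟨a ^ d * x⟩`,
where `x` lifts `π b ^ e`, satisfies `x ^ (n / e) = 1` and commutes with `a ^ d`. Commutation means
`m / d ∣ r ^ e - 1`, whichever lift is taken. When it holds, every lift gives a different subgroup,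
so one counts lifts (`ncard_lifts`): there are `gcd(m, S)` of them with `S = (r ^ n - 1) / (r ^ e -
1)` (for `r ≥ 2`), which equals `gcd(d, S)` by `gcd_geom_sum`.

Summing over pairs of coprime indices gives the formula. -/

theorem Subgroup.ncard_orbit_quotient (H K : Subgroup G) :
    (MulAction.orbit H ((1 : G) : G ⧸ K)).ncard = K.relIndex H := by
  rw [← MulAction.index_stabilizer, Subgroup.relIndex]
  congr 1
  ext h
  rw [MulAction.mem_stabilizer_iff, Subgroup.mem_subgroupOf]
  change (((h : G) * 1 : G) : G ⧸ K) = _ ↔ _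
  rw [mul_one, eq_comm, QuotientGroup.eq, inv_one, one_mul]

theorem Subgroup.mul_eq_univ_iff_orbit (H K : Subgroup G) :
    (H : Set G) * (K : Set G) = Set.univ ↔
      MulAction.orbit H ((1 : G) : G ⧸ K) = Set.univ := by
  simp only [Set.eq_univ_iff_forall]
  constructor
  · intro h x
    obtain ⟨g, rfl⟩ := QuotientGroup.mk_surjective x
    obtain ⟨u, hu, v, hv, rfl⟩ := h g
    refine ⟨⟨u, hu⟩, ?_⟩
    change ((u * 1 : G) : G ⧸ K) = _
    rw [QuotientGroup.eq]
    simpa using hv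
  · intro h g
    obtain ⟨⟨u, hu⟩, hg⟩ := h g
    change ((u * 1 : G) : G ⧸ K) = _ at hg
    rw [QuotientGroup.eq, mul_one] at hg
    exact ⟨u, hu, u⁻¹ * g, hg, by simp⟩

theorem Subgroup.index_dvd_card_of_mul_eq_univ {H K : Subgroup G}
    (h : (H : Set G) * (K : Set G) = Set.univ) : K.index ∣ Nat.card H := by
  have h1 := Subgroup.ncard_orbit_quotient H K
  rw [(Subgroup.mul_eq_univ_iff_orbit H K).1 h, Set.ncard_univ] at h1
  rw [Subgroup.index, h1]
  exact Subgroup.relIndex_dvd_card K H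

/-- Computing the index of `H ⊓ K` through `H` shows that `K.index` divides `K.relIndex H *
H.index`. By coprimality it divides `K.relIndex H`, the size of the `H`-orbit of the trivial coset,
so that orbit is all of `G ⧸ K`. -/
theorem Subgroup.mul_eq_univ_of_coprime_index [Finite G] {H K : Subgroup G}
    (h : H.index.Coprime K.index) : (H : Set G) * (K : Set G) = Set.univ := by
  rw [Subgroup.mul_eq_univ_iff_orbit]
  refine Set.eq_of_subset_of_ncard_le (Set.subset_univ _) ?_
  rw [Set.ncard_univ, Subgroup.ncard_orbit_quotient]
  change K.index ≤ _
  have h1 : K.index ∣ K.relIndex H * H.index := by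
    rw [← Subgroup.inf_relIndex_right, Subgroup.relIndex_mul_index inf_le_right]
    exact Subgroup.index_dvd_of_le inf_le_left
  exact Nat.le_of_dvd (Nat.pos_of_ne_zero (Subgroup.index_ne_zero_of_finite (H := K.subgroupOf H)))
    (h.symm.dvd_of_dvd_mul_right h1)

end ProductSets

/-! ### Subgroups of cyclic groups. -/

section CyclicGroups

variable {G : Type*} [Group G]

theorem mem_zpowers_pow_of_pow_eq_one {c g : G} {d k : ℕ} (hk : 0 < k) (hc : orderOf c = d * k)
    (hg : g ∈ Subgroup.zpowers c) (hgk : g ^ k = 1) : g ∈ Subgroup.zpowers (c ^ d) := by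
  obtain ⟨i, rfl⟩ := hg
  simp only at hgk
  rw [← zpow_natCast, ← zpow_mul, ← orderOf_dvd_iff_zpow_eq_one, hc] at hgk
  push_cast at hgk
  obtain ⟨j, rfl⟩ := Int.dvd_of_mul_dvd_mul_right (by exact_mod_cast hk.ne') hgk
  simp only
  rw [zpow_mul, zpow_natCast]
  exact zpow_mem (Subgroup.mem_zpowers _) j

theorem zpowers_eq_zpowers_pow_of_orderOf_eq {c g : G} {d k : ℕ} (hd : 0 < d) (hk : 0 < k)
    (hc : orderOf c = d * k) (hg : g ∈ Subgroup.zpowers c) (hgk : orderOf g = k) :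
    Subgroup.zpowers g = Subgroup.zpowers (c ^ d) := by
  have hle : Subgroup.zpowers g ≤ Subgroup.zpowers (c ^ d) :=
    Subgroup.zpowers_le.2
      (mem_zpowers_pow_of_pow_eq_one hk hc hg (by rw [← hgk, pow_orderOf_eq_one]))
  have hcd : Nat.card (Subgroup.zpowers (c ^ d)) = k := by
    rw [Nat.card_zpowers, orderOf_pow_of_dvd hd.ne' (by rw [hc]; exact dvd_mul_right _ _), hc,
      Nat.mul_div_cancel_left _ hd]
  have : Finite (Subgroup.zpowers (c ^ d)) := Nat.finite_of_card_ne_zero (by rw [hcd]; exact hk.ne')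
  exact Subgroup.eq_of_le_of_card_ge hle (by rw [hcd, Nat.card_zpowers, hgk])

theorem Commute.mem_zpowers_mul_right {u v : G} (h : Commute u v)
    (huv : (orderOf u).Coprime (orderOf v)) : v ∈ Subgroup.zpowers (u * v) := by
  have h1 : (u * v) ^ orderOf u = v ^ orderOf u := by
    rw [h.mul_pow, pow_orderOf_eq_one, one_mul]
  have h2 : v ∈ Subgroup.zpowers (v ^ orderOf u) := mem_zpowers_pow_iff.2 huv
  rw [← h1] at h2
  exact Subgroup.zpowers_le.2 (pow_mem (Subgroup.mem_zpowers (u * v)) _) h2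

end CyclicGroups

/-- `G` is an extension of `⟨π b⟩`, of order `n`, by the cyclic normal subgroup `⟨a⟩` of coprime
order `m`, split by `b`, which acts on `⟨a⟩` by the `r`-th power map. -/
structure IsMetacyclicExt {G C : Type*} [Group G] [CommGroup C] (π : G →* C) (a b : G)
    (m n r : ℕ) : Prop where
  pos_left : 0 < m
  pos_right : 0 < n
  coprime : m.Coprime n
  orderOf_left : orderOf a = m
  pow_right : b ^ n = 1
  conj : b⁻¹ * a * b = a ^ r
  ker_eq : π.ker = Subgroup.zpowers a
  orderOf_map : orderOf (π b) = n
  map_mem : ∀ g, π g ∈ Subgroup.zpowers (π b)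

/-! ### Power formulas, lifts of `π b ^ e`, and the coprime-index criterion. -/

namespace IsMetacyclicExt

variable {G C : Type*} [Group G] [CommGroup C] {π : G →* C} {a b : G} {m n r : ℕ}

theorem card_eq (h : IsMetacyclicExt π a b m n r) : Nat.card G = m * n := by
  have h1 := π.ker.card_mul_index
  rw [Subgroup.index_ker] at h1
  have h2 : π.range = Subgroup.zpowers (π b) := by
    apply le_antisymm
    · rintro _ ⟨g, rfl⟩
      exact h.map_mem g
    · rw [Subgroup.zpowers_le]
      exact ⟨b, rfl⟩
  rw [h2, h.ker_eq, Nat.card_zpowers, Nat.card_zpowers, h.orderOf_left, h.orderOf_map] at h1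
  exact h1.symm

theorem finite (h : IsMetacyclicExt π a b m n r) : Finite G :=
  Nat.finite_of_card_ne_zero (by rw [h.card_eq]; exact (mul_pos h.pos_left h.pos_right).ne')

theorem map_pow_eq_one (h : IsMetacyclicExt π a b m n r) (g : G) : π g ^ n = 1 := by
  obtain ⟨k, hk⟩ := h.map_mem g
  simp only at hk
  rw [← hk, ← zpow_natCast, zpow_comm, zpow_natCast, ← h.orderOf_map, pow_orderOf_eq_one, one_zpow]

theorem pow_eq_one_iff_mem (h : IsMetacyclicExt π a b m n r) {g : G} :
    g ^ m = 1 ↔ g ∈ Subgroup.zpowers a := by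
  constructor
  · intro hg
    rw [← h.ker_eq, MonoidHom.mem_ker]
    have h1 : π g ^ m = 1 := by rw [← map_pow, hg, map_one]
    have := pow_gcd_eq_one.2 ⟨h1, h.map_pow_eq_one g⟩
    rwa [h.coprime.gcd_eq_one, pow_one] at this
  · rintro ⟨k, rfl⟩
    simp only
    rw [← zpow_natCast, zpow_comm, zpow_natCast, ← h.orderOf_left, pow_orderOf_eq_one, one_zpow]

theorem mul_pow_comm (h : IsMetacyclicExt π a b m n r) {z : G} (hz : z ∈ Subgroup.zpowers a)
    (j : ℕ) : z * b ^ j = b ^ j * z ^ r ^ j := by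
  have h1 : ∀ w ∈ Subgroup.zpowers a, w * b = b * w ^ r := by
    rintro _ ⟨k, rfl⟩
    simp only
    have h2 : (b⁻¹ * a * b) ^ k = b⁻¹ * a ^ k * b := by
      simpa using conj_zpow (a := b⁻¹) (b := a) (i := k)
    rw [h.conj] at h2
    rw [← zpow_natCast, zpow_comm, zpow_natCast, h2]
    group
  induction j with
  | zero => simp
  | succ j ih =>
    rw [pow_succ, ← mul_assoc, ih, mul_assoc, h1 _ (pow_mem hz _), ← mul_assoc, ← pow_mul,
      ← pow_succ r]

theorem pow_mul_pow (h : IsMetacyclicExt π a b m n r) {z : G} (hz : z ∈ Subgroup.zpowers a)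
    (e k : ℕ) :
    (b ^ e * z) ^ k = b ^ (e * k) * z ^ ∑ i ∈ Finset.range k, (r ^ e) ^ i := by
  induction k with
  | zero => simp
  | succ k ih =>
    rw [pow_succ', ih, mul_assoc, ← mul_assoc z, h.mul_pow_comm hz, Finset.sum_range_succ,
      ← pow_mul r, mul_assoc, ← pow_add, ← mul_assoc, ← pow_add]
    congr 2 <;> ring

theorem commute_iff (h : IsMetacyclicExt π a b m n r) {z : G} (hz : z ∈ Subgroup.zpowers a)
    {d e : ℕ} (hd : d ∣ m) :
    Commute (a ^ d) (b ^ e * z) ↔ ((m / d : ℕ) : ℤ) ∣ (r : ℤ) ^ e - 1 := by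
  have hcz : Commute (a ^ d) z := by
    obtain ⟨k, rfl⟩ := hz
    exact ((Commute.refl a).zpow_right k).pow_left d
  have had : a ^ d ∈ Subgroup.zpowers a := pow_mem (Subgroup.mem_zpowers a) d
  obtain ⟨k, rfl⟩ := hd
  have hd0 : 0 < d := Nat.pos_of_ne_zero fun h0 => by
    have := h.pos_left
    simp [h0] at this
  rw [Nat.mul_div_cancel_left _ hd0, commute_iff_eq, ← mul_assoc, h.mul_pow_comm had,
    mul_assoc, mul_assoc, ← hcz.eq, mul_right_inj, mul_left_inj, ← pow_mul, eq_comm,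
    pow_eq_pow_iff_modEq, h.orderOf_left]
  rw [Nat.modEq_iff_dvd]
  push_cast
  rw [show (d : ℤ) * (r : ℤ) ^ e - d = d * ((r : ℤ) ^ e - 1) by ring]
  exact Int.mul_dvd_mul_iff_left (by exact_mod_cast hd0.ne')

-- The elements over `π b ^ e` are `b ^ e * z` with `z ∈ ⟨a⟩`, and `(b ^ e * z) ^ (n / e) = z ^ S`
-- for the geometric sum `S`. The count is thus the size of the kernel of the `S`-th power map on a
-- cyclic group of order `m`.
open scoped IsMulCommutative in
theorem ncard_lifts (h : IsMetacyclicExt π a b m n r) {e : ℕ} (he : e ∣ n) :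
    {x : G | π x = π b ^ e ∧ x ^ (n / e) = 1}.ncard =
      m.gcd (∑ i ∈ Finset.range (n / e), (r ^ e) ^ i) := by
  have := h.finite
  set S := ∑ i ∈ Finset.range (n / e), (r ^ e) ^ i with hS
  have h1 := IsCyclic.card_powMonoidHom_ker (Subgroup.zpowers a) S
  rw [Nat.card_zpowers, h.orderOf_left] at h1
  rw [← h1]
  have key : ∀ z ∈ Subgroup.zpowers a, (b ^ e * z) ^ (n / e) = z ^ S := by
    intro z hz
    rw [h.pow_mul_pow hz, Nat.mul_div_cancel' he, h.pow_right, one_mul]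
  symm
  rw [← Nat.card_coe_set_eq]
  refine Nat.card_congr (Equiv.ofBijective
    (fun z => ⟨b ^ e * ((z : Subgroup.zpowers a) : G), ?_, ?_⟩) ⟨?_, ?_⟩)
  · have : π ((z : Subgroup.zpowers a) : G) = 1 := by
      rw [← MonoidHom.mem_ker, h.ker_eq]
      exact z.1.2
    rw [map_mul, this, map_pow, mul_one]
  · rw [key _ z.1.2]
    have := z.2
    rw [MonoidHom.mem_ker, powMonoidHom_apply] at this
    simpa using congrArg Subtype.val this
  · intro z w hzw
    exact Subtype.ext (Subtype.ext (mul_left_cancel (congrArg Subtype.val hzw)))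
  · rintro ⟨x, hx, hx1⟩
    have hz : (b ^ e)⁻¹ * x ∈ Subgroup.zpowers a := by
      rw [← h.ker_eq, MonoidHom.mem_ker, map_mul, map_inv, map_pow, hx, inv_mul_cancel]
    refine ⟨⟨⟨_, hz⟩, ?_⟩, ?_⟩
    · rw [MonoidHom.mem_ker, powMonoidHom_apply]
      apply Subtype.ext
      have := key _ hz
      rw [mul_inv_cancel_left, hx1] at this
      simpa using this.symm
    · simp

/-- A prime `p` dividing both indices divides `m` or `n`. In each case both subgroups become too
small in a suitable quotient: `G ⧸ ⟨a ^ p⟩` if `p ∣ m`, the image of `π` if `p ∣ n`. -/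
theorem coprime_index_of_mul_eq_univ (h : IsMetacyclicExt π a b m n r) {H K : Subgroup G}
    (hHK : (H : Set G) * (K : Set G) = Set.univ) : H.index.Coprime K.index := by
  have := h.finite
  have hm := h.pos_left
  have hn := h.pos_right
  refine Nat.Coprime.symm (Nat.coprime_of_dvd ?_)
  intro p hp hpK hpH
  have hpmn : p ∣ m * n := h.card_eq ▸ hpH.trans H.index_dvd_card
  have hpow : ∀ L : Subgroup G, p ∣ L.index → Nat.card L * p ∣ m * n := by
    intro L hL
    rw [← h.card_eq, ← L.card_mul_index]
    exact mul_dvd_mul_left _ hL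
  rcases (Nat.Prime.dvd_mul hp).1 hpmn with hpm | hpn
  · obtain ⟨k, rfl⟩ := hpm
    have hk : 0 < k := Nat.pos_of_mul_pos_left hm
    have hpn : p.Coprime n := Nat.Coprime.coprime_mul_right h.coprime
    -- `N` consists of all `g` with `g ^ k = 1`, hence is normal.
    let N := Subgroup.zpowers (a ^ p)
    have hNle : N ≤ Subgroup.zpowers a :=
      Subgroup.zpowers_le.2 (pow_mem (Subgroup.mem_zpowers a) p)
    have hcardN : Nat.card N = k := by
      rw [Nat.card_zpowers, orderOf_pow_of_dvd hp.ne_zero (by rw [h.orderOf_left]; simp),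
        h.orderOf_left, Nat.mul_div_cancel_left _ hp.pos]
    have hmemN : ∀ g, g ^ k = 1 → g ∈ N := by
      intro g hg
      refine mem_zpowers_pow_of_pow_eq_one hk h.orderOf_left ?_ hg
      rw [← h.pow_eq_one_iff_mem, mul_comm, pow_mul, hg, one_pow]
    have hNk : ∀ g ∈ N, g ^ k = 1 := by
      intro g hg
      have := orderOf_dvd_iff_pow_eq_one.1 (N.orderOf_dvd_natCard hg)
      rwa [hcardN] at this
    have hN : N.Normal := ⟨fun g hg x => hmemN _ (by
      rw [conj_pow, hNk g hg, mul_one, mul_inv_cancel])⟩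
    -- Elements of `L ⊓ ⟨a⟩` are killed by both `p * k` and `n * k`, hence by `k`. So `L` meets `N`
    -- and `π.ker` in the same subgroup, and its images in `G ⧸ N` and under `π` have equal order.
    have hrel : ∀ L : Subgroup G, p ∣ L.index → Nat.card (L.map (QuotientGroup.mk' N)) ∣ n := by
      intro L hL
      have h1 : L ⊓ N = L ⊓ π.ker := by
        apply le_antisymm
        · rw [h.ker_eq]
          exact inf_le_inf_left _ hNle
        · rintro g ⟨hgL, hga⟩
          refine ⟨hgL, hmemN g ?_⟩
          rw [h.ker_eq] at hga
          replace hga := h.pow_eq_one_iff_mem.2 hga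
          have h2 : g ^ (n * k) = 1 := by
            have h3 : g ^ Nat.card L = 1 := orderOf_dvd_iff_pow_eq_one.1 (L.orderOf_dvd_natCard hgL)
            have h4 : Nat.card L ∣ n * k := by
              apply Nat.dvd_of_mul_dvd_mul_right hp.pos
              convert! hpow L hL using 1
              ring
            exact orderOf_dvd_iff_pow_eq_one.1 ((orderOf_dvd_of_pow_eq_one h3).trans h4)
          have := pow_gcd_eq_one.2 ⟨hga, h2⟩
          rwa [Nat.gcd_mul_right, hpn.gcd_eq_one, one_mul] at this
      have h2 := Subgroup.relIndex_ker L (QuotientGroup.mk' N)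
      rw [QuotientGroup.ker_mk', ← Subgroup.inf_relIndex_left, h1,
        Subgroup.inf_relIndex_left] at h2
      rw [← h2, Subgroup.relIndex_ker]
      refine (Subgroup.card_dvd_of_le (K := Subgroup.zpowers (π b)) ?_).trans ?_
      · rintro _ ⟨g, -, rfl⟩
        exact h.map_mem g
      · rw [Nat.card_zpowers, h.orderOf_map]
    have hprod : ((H.map (QuotientGroup.mk' N) : Subgroup (G ⧸ N)) : Set (G ⧸ N)) *
        ((K.map (QuotientGroup.mk' N) : Subgroup (G ⧸ N)) : Set (G ⧸ N)) = Set.univ := by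
      rw [Subgroup.coe_map, Subgroup.coe_map, ← Set.image_mul, hHK, Set.image_univ,
        Set.range_eq_univ]
      exact QuotientGroup.mk'_surjective N
    have h5 : Nat.card (G ⧸ N) = p * n := by
      have h6 := N.card_mul_index
      rw [hcardN, h.card_eq] at h6
      exact Nat.eq_of_mul_eq_mul_left hk (h6.trans (by ring))
    have h7 := (K.map (QuotientGroup.mk' N)).card_mul_index
    rw [h5] at h7
    -- The image of `K` has order dividing `n`, and its index divides the order of the image of `H`,
    -- so `p * n ∣ n * n`.
    have h8 : p ∣ n * n := by
      refine (Dvd.intro n rfl).trans (h7 ▸ ?_)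
      exact mul_dvd_mul (hrel K hpK)
        ((Subgroup.index_dvd_card_of_mul_eq_univ hprod).trans (hrel H hpH))
    have h9 : p ∣ 1 := by
      rw [← (hpn.mul_right hpn).gcd_eq_one]
      exact Nat.dvd_gcd dvd_rfl h8
    exact hp.one_lt.ne' (Nat.dvd_one.1 h9)
  · obtain ⟨k, rfl⟩ := hpn
    have hk : 0 < k := Nat.pos_of_mul_pos_left hn
    have hmp : p.Coprime m := (Nat.Coprime.coprime_mul_right_right h.coprime).symm
    have hker : ∀ L : Subgroup G, p ∣ L.index → ∀ g ∈ L, π g ^ k = 1 := by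
      intro L hL g hg
      have h3 : π g ^ Nat.card L = 1 := by 
        rw [← map_pow, orderOf_dvd_iff_pow_eq_one.1 (L.orderOf_dvd_natCard hg), map_one]
      have h4 : Nat.card L ∣ m * k := by
        apply Nat.dvd_of_mul_dvd_mul_right hp.pos
        convert! hpow L hL using 1
        ring
      have h5 := pow_gcd_eq_one.2 ⟨h.map_pow_eq_one g,
        orderOf_dvd_iff_pow_eq_one.1 ((orderOf_dvd_of_pow_eq_one h3).trans h4)⟩
      rwa [Nat.gcd_mul_right, hmp.gcd_eq_one, one_mul] at h5
    obtain ⟨u, hu, v, hv, huv⟩ : b ∈ (H : Set G) * (K : Set G) := hHK ▸ Set.mem_univ b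
    have h6 : π b ^ k = 1 := by
      rw [← huv]
      simp only
      rw [map_mul, mul_pow, hker H hpH u hu, hker K hpK v hv, mul_one]
    have h7 := Nat.le_of_dvd hk (orderOf_dvd_of_pow_eq_one h6)
    rw [h.orderOf_map] at h7
    nlinarith [hp.two_le]

theorem mul_eq_univ_iff (h : IsMetacyclicExt π a b m n r) {H K : Subgroup G} :
    (H : Set G) * (K : Set G) = Set.univ ↔ H.index.Coprime K.index :=
  have := h.finite
  ⟨h.coprime_index_of_mul_eq_univ, Subgroup.mul_eq_univ_of_coprime_index⟩

end IsMetacyclicExt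

/-! ### Cyclic subgroups of given index. -/

namespace IsMetacyclicExt

variable {G C : Type*} [Group G] [CommGroup C] {π : G →* C} {a b : G} {m n r : ℕ}

theorem commute_lift_iff (h : IsMetacyclicExt π a b m n r) {x : G} {d e : ℕ} (hd : d ∣ m)
    (hx : π x = π b ^ e) :
    Commute (a ^ d) x ↔ ((m / d : ℕ) : ℤ) ∣ (r : ℤ) ^ e - 1 := by
  have hz : (b ^ e)⁻¹ * x ∈ Subgroup.zpowers a := by
    rw [← h.ker_eq, MonoidHom.mem_ker, map_mul, map_inv, map_pow, hx, inv_mul_cancel]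
  rw [← h.commute_iff hz hd, mul_inv_cancel_left]

theorem orderOf_pow_left (h : IsMetacyclicExt π a b m n r) {d : ℕ} (hd : d ∣ m) :
    orderOf (a ^ d) = m / d := by
  rw [orderOf_pow_of_dvd (Nat.pos_of_dvd_of_pos hd h.pos_left).ne' (h.orderOf_left ▸ hd),
    h.orderOf_left]

theorem orderOf_map_pow (h : IsMetacyclicExt π a b m n r) {e : ℕ} (he : e ∣ n) :
    orderOf (π b ^ e) = n / e := by
  rw [orderOf_pow_of_dvd (Nat.pos_of_dvd_of_pos he h.pos_right).ne' (h.orderOf_map ▸ he),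
    h.orderOf_map]

theorem orderOf_lift (h : IsMetacyclicExt π a b m n r) {x : G} {e : ℕ} (he : e ∣ n)
    (hx : π x = π b ^ e) (hx1 : x ^ (n / e) = 1) : orderOf x = n / e := by
  refine Nat.dvd_antisymm (orderOf_dvd_of_pow_eq_one hx1) ?_
  rw [← h.orderOf_map_pow he, ← hx]
  exact orderOf_map_dvd π x

theorem coprime_div (h : IsMetacyclicExt π a b m n r) {d e : ℕ} (hd : d ∣ m) (he : e ∣ n) :
    (m / d).Coprime (n / e) :=
  (h.coprime.coprime_dvd_left (Nat.div_dvd_of_dvd hd)).coprime_dvd_right (Nat.div_dvd_of_dvd he)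

theorem index_eq_iff (h : IsMetacyclicExt π a b m n r) {d e : ℕ} (hd : d ∣ m) (he : e ∣ n)
    (H : Subgroup G) : H.index = d * e ↔ Nat.card H = m / d * (n / e) := by
  have h1 := H.card_mul_index
  rw [h.card_eq] at h1
  have hm := h.pos_left
  have hn := h.pos_right
  obtain ⟨k, rfl⟩ := hd
  obtain ⟨l, rfl⟩ := he
  have hd0 : 0 < d := Nat.pos_of_mul_pos_right hm
  have he0 : 0 < e := Nat.pos_of_mul_pos_right hn
  have hk0 : 0 < k := Nat.pos_of_mul_pos_left hm
  have hl0 : 0 < l := Nat.pos_of_mul_pos_left hn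
  rw [Nat.mul_div_cancel_left _ hd0, Nat.mul_div_cancel_left _ he0]
  constructor
  · intro h2
    rw [h2] at h1
    exact Nat.eq_of_mul_eq_mul_right (mul_pos hd0 he0) (h1.trans (by ring))
  · intro h2
    rw [h2] at h1
    exact Nat.eq_of_mul_eq_mul_left (mul_pos hk0 hl0) (h1.trans (by ring))

theorem exists_lift (h : IsMetacyclicExt π a b m n r) {d e : ℕ} (hd : d ∣ m) (he : e ∣ n)
    {H : Subgroup G} (hH : IsCyclic H) (hi : H.index = d * e) :
    ∃ x, (π x = π b ^ e ∧ x ^ (n / e) = 1) ∧ Commute (a ^ d) x ∧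
      H = Subgroup.zpowers (a ^ d * x) := by
  have hfin := h.finite
  rw [h.index_eq_iff hd he] at hi
  obtain ⟨y, rfl⟩ := (Subgroup.isCyclic_iff_exists_zpowers_eq_top H).1 hH
  have hd0 : 0 < d := Nat.pos_of_dvd_of_pos hd h.pos_left
  have he0 : 0 < e := Nat.pos_of_dvd_of_pos he h.pos_right
  have hk0 : 0 < m / d := Nat.div_pos (Nat.le_of_dvd h.pos_left hd) hd0
  have hl0 : 0 < n / e := Nat.div_pos (Nat.le_of_dvd h.pos_right he) he0
  rw [Nat.card_zpowers] at hi
  -- The generator `y` is split into its coprime parts: `y ^ (n / e)` generates `⟨a ^ d⟩`, and a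
  -- power of `y ^ (m / d)` will be the lift `x`.
  have hw : orderOf (y ^ (n / e)) = m / d := by
    rw [orderOf_pow_of_dvd hl0.ne' (by rw [hi]; exact dvd_mul_left _ _), hi,
      Nat.mul_div_cancel _ hl0]
  have hv : orderOf (y ^ (m / d)) = n / e := by
    rw [orderOf_pow_of_dvd hk0.ne' (by rw [hi]; exact dvd_mul_right _ _), hi,
      Nat.mul_div_cancel_left _ hk0]
  have hwa : y ^ (n / e) ∈ Subgroup.zpowers a := by
    rw [← h.pow_eq_one_iff_mem, ← orderOf_dvd_iff_pow_eq_one, hw]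
    exact Nat.div_dvd_of_dvd hd
  have hwd := zpowers_eq_zpowers_pow_of_orderOf_eq hd0 hk0
    (h.orderOf_left.trans (Nat.mul_div_cancel' hd).symm) hwa hw
  have had : a ^ d ∈ Subgroup.zpowers y := by
    have : a ^ d ∈ Subgroup.zpowers (y ^ (n / e)) := hwd ▸ Subgroup.mem_zpowers _
    exact Subgroup.zpowers_le.2 (pow_mem (Subgroup.mem_zpowers y) _) this
  have hpv : orderOf (π (y ^ (m / d))) = n / e := by
    refine Nat.dvd_antisymm (hv ▸ orderOf_map_dvd π _) ?_
    have h1 : (y ^ (m / d)) ^ orderOf (π (y ^ (m / d))) ∈ Subgroup.zpowers a := by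
      rw [← h.ker_eq, MonoidHom.mem_ker, map_pow, pow_orderOf_eq_one]
    rw [← h.pow_eq_one_iff_mem, ← pow_mul, ← orderOf_dvd_iff_pow_eq_one, hv] at h1
    exact (h.coprime.symm.coprime_dvd_left (Nat.div_dvd_of_dvd he)).dvd_of_dvd_mul_right h1
  have hpe := zpowers_eq_zpowers_pow_of_orderOf_eq he0 hl0
    (h.orderOf_map.trans (Nat.mul_div_cancel' he).symm) (h.map_mem _) hpv
  obtain ⟨i, hi1⟩ : π b ^ e ∈ Subgroup.zpowers (π (y ^ (m / d))) := hpe ▸ Subgroup.mem_zpowers _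
  have hxy : (y ^ (m / d)) ^ i ∈ Subgroup.zpowers y :=
    zpow_mem (pow_mem (Subgroup.mem_zpowers y) _) i
  have hx1 : ((y ^ (m / d)) ^ i) ^ (n / e) = 1 := by
    rw [← zpow_natCast, zpow_comm, zpow_natCast, ← hv, pow_orderOf_eq_one, one_zpow]
  have hpx : π ((y ^ (m / d)) ^ i) = π b ^ e := by rw [map_zpow]; exact hi1
  have hcomm : Commute (a ^ d) ((y ^ (m / d)) ^ i) := by
    obtain ⟨s, hs⟩ := had
    obtain ⟨t, ht⟩ := hxy
    rw [← hs, ← ht]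
    exact ((Commute.refl y).zpow_right t).zpow_left s
  refine ⟨_, ⟨hpx, hx1⟩, hcomm, ?_⟩
  symm
  refine Subgroup.eq_of_le_of_card_ge (Subgroup.zpowers_le.2 (mul_mem had hxy)) ?_
  rw [Nat.card_zpowers, Nat.card_zpowers, hi, hcomm.orderOf_mul_eq_mul_orderOf_of_coprime,
    h.orderOf_lift he hpx hx1, h.orderOf_pow_left hd]
  rw [h.orderOf_lift he hpx hx1, h.orderOf_pow_left hd]
  exact h.coprime_div hd he

theorem ncard_cyclic_index_eq (h : IsMetacyclicExt π a b m n r) {d e : ℕ} (hd : d ∣ m)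
    (he : e ∣ n) (hr : ((m / d : ℕ) : ℤ) ∣ (r : ℤ) ^ e - 1) :
    {H : Subgroup G | IsCyclic H ∧ H.index = d * e}.ncard =
      m.gcd (∑ i ∈ Finset.range (n / e), (r ^ e) ^ i) := by
  rw [← h.ncard_lifts he]
  symm
  have hcop : ∀ x, π x = π b ^ e ∧ x ^ (n / e) = 1 →
      (orderOf (a ^ d)).Coprime (orderOf x) := by
    rintro x ⟨hx, hx1⟩
    rw [h.orderOf_lift he hx hx1, h.orderOf_pow_left hd]
    exact h.coprime_div hd he
  have hcomm : ∀ x, π x = π b ^ e ∧ x ^ (n / e) = 1 → Commute (a ^ d) x :=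
    fun x hx => (h.commute_lift_iff hd hx.1).2 hr
  refine Set.ncard_congr (fun x _ => Subgroup.zpowers (a ^ d * x)) ?_ ?_ ?_
  · rintro x hx
    refine ⟨inferInstance, ?_⟩
    rw [h.index_eq_iff hd he, Nat.card_zpowers,
      (hcomm x hx).orderOf_mul_eq_mul_orderOf_of_coprime (hcop x hx),
      h.orderOf_lift he hx.1 hx.2, h.orderOf_pow_left hd]
  · intro x y hx hy hxy
    have h1 : x ∈ Subgroup.zpowers (a ^ d * x) := (hcomm x hx).mem_zpowers_mul_right (hcop x hx)
    have h2 : y ∈ Subgroup.zpowers (a ^ d * x) :=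
      hxy ▸ (hcomm y hy).mem_zpowers_mul_right (hcop y hy)
    -- Both lifts lie in one cyclic group, so `x * y⁻¹` is killed by the coprime exponents `n / e`
    -- and `m`.
    have h3 : Commute x y := by
      obtain ⟨s, hs⟩ := h1
      obtain ⟨t, ht⟩ := h2
      rw [← hs, ← ht]
      exact ((Commute.refl _).zpow_right t).zpow_left s
    have h4 : (x * y⁻¹) ^ (n / e) = 1 := by
      rw [h3.inv_right.mul_pow, inv_pow, hx.2, hy.2, inv_one, mul_one]
    have h5 : (x * y⁻¹) ^ m = 1 := by
      rw [h.pow_eq_one_iff_mem, ← h.ker_eq, MonoidHom.mem_ker, map_mul, map_inv, hx.1, hy.1,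
        mul_inv_cancel]
    have h6 := pow_gcd_eq_one.2 ⟨h5, h4⟩
    rwa [(h.coprime.coprime_dvd_right (Nat.div_dvd_of_dvd he)).gcd_eq_one, pow_one,
      mul_inv_eq_one] at h6
  · rintro H ⟨hH, hi⟩
    obtain ⟨x, hx, -, rfl⟩ := h.exists_lift hd he hH hi
    exact ⟨x, hx, rfl⟩

/-- Modulo `m / d` each term of the sum is `1`, so the sum is congruent to `n / e`, which is prime
to `m / d`; that factor of `m` does not affect the gcd. -/
theorem gcd_geom_sum (h : IsMetacyclicExt π a b m n r) {d e : ℕ} (hd : d ∣ m)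
    (he : e ∣ n) (hr : ((m / d : ℕ) : ℤ) ∣ (r : ℤ) ^ e - 1) :
    m.gcd (∑ i ∈ Finset.range (n / e), (r ^ e) ^ i) =
      d.gcd (∑ i ∈ Finset.range (n / e), (r ^ e) ^ i) := by
  set S := ∑ i ∈ Finset.range (n / e), (r ^ e) ^ i with hS
  have h1 : S ≡ n / e [MOD m / d] := by
    have h2 : r ^ e ≡ 1 [MOD m / d] :=
      (Nat.modEq_iff_dvd.2 (by push_cast; push_cast at hr; exact hr)).symm
    have h3 : ∀ k, ∑ i ∈ Finset.range k, (r ^ e) ^ i ≡ k [MOD m / d] := by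
      intro k
      induction k with
      | zero => rfl
      | succ k ih =>
        rw [Finset.sum_range_succ]
        simpa using ih.add (h2.pow k)
    exact h3 _
  have h4 : (m / d).Coprime S := by
    rw [Nat.coprime_iff_gcd_eq_one, Nat.gcd_comm, h1.gcd_eq, Nat.gcd_comm]
    exact h.coprime_div hd he
  conv_lhs => rw [← Nat.div_mul_cancel hd]
  exact Nat.Coprime.gcd_mul_left_cancel d h4

end IsMetacyclicExt

/-! ### Divisor arithmetic and the summation formula. -/

theorem geom_sum_eq_int_div {r n e : ℕ} (hr : 2 ≤ r) (he0 : 0 < e) (he : e ∣ n) :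
    ((r : ℤ) ^ n - 1) / ((r : ℤ) ^ e - 1) =
      ((∑ i ∈ Finset.range (n / e), (r ^ e) ^ i : ℕ) : ℤ) := by
  have h1 : (1 : ℤ) < (r : ℤ) ^ e := one_lt_pow₀ (by exact_mod_cast hr) he0.ne'
  refine Int.ediv_eq_of_eq_mul_left (by linarith) ?_
  push_cast
  rw [geom_sum_mul, ← pow_mul, Nat.mul_div_cancel' he]

theorem Nat.Coprime.sum_divisors_mul_eq {M : Type*} [AddCommMonoid M] {m n : ℕ}
    (hmn : m.Coprime n) (f : ℕ → M) :
    ∑ D ∈ (m * n).divisors, f D = ∑ d ∈ m.divisors, ∑ e ∈ n.divisors, f (d * e) := by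
  rw [hmn.divisors_mul, Finset.sum_map, ← Finset.sum_product']
  exact Finset.sum_attach (m.divisors ×ˢ n.divisors) fun p => f (p.1 * p.2)

theorem Nat.coprime_mul_mul_iff_of_dvd {m n d e d' e' : ℕ} (hmn : m.Coprime n) (hd : d ∣ m)
    (he : e ∣ n) (hd' : d' ∣ m) (he' : e' ∣ n) :
    (d * e).Coprime (d' * e') ↔ d.Coprime d' ∧ e.Coprime e' := by
  have h1 : d.Coprime e' := (hmn.coprime_dvd_left hd).coprime_dvd_right he'
  have h2 : e.Coprime d' := ((hmn.coprime_dvd_left hd').coprime_dvd_right he).symm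
  rw [Nat.coprime_mul_iff_left, Nat.coprime_mul_iff_right, Nat.coprime_mul_iff_right]
  tauto

namespace IsMetacyclicExt

variable {G C : Type*} [Group G] [CommGroup C] {π : G →* C} {a b : G} {m n r : ℕ}

theorem gcd_int_div_eq (h : IsMetacyclicExt π a b m n r)
    (hmr : Int.gcd (m : ℤ) ((r : ℤ) - 1) = 1) (hrn : r ^ n ≡ 1 [MOD m]) {d e : ℕ} (hd : d ∣ m)
    (he : e ∣ n) (hr : ((m / d : ℕ) : ℤ) ∣ (r : ℤ) ^ e - 1) :
    Int.gcd (d : ℤ) (((r : ℤ) ^ n - 1) / ((r : ℤ) ^ e - 1)) =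
      m.gcd (∑ i ∈ Finset.range (n / e), (r ^ e) ^ i) := by
  -- If `r ≤ 1` then `m = 1`, and the gcd is `1` whatever the quotient, including `0 / 0 = 0` at `r
  -- = 1`.
  rcases Nat.lt_or_ge r 2 with hr2 | hr2
  · have hm1 : m = 1 := by
      interval_cases r
      · rw [zero_pow h.pos_right.ne'] at hrn
        have := (Nat.modEq_iff_dvd' zero_le_one).1 hrn
        simpa using this
      · simpa using hmr
    subst hm1
    rw [Nat.dvd_one] at hd
    subst hd
    simp
  · rw [h.gcd_geom_sum hd he hr,
      geom_sum_eq_int_div hr2 (Nat.pos_of_dvd_of_pos he h.pos_right) he, Int.gcd_natCast_natCast]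

theorem ncard_cyclic_index (h : IsMetacyclicExt π a b m n r)
    (hmr : Int.gcd (m : ℤ) ((r : ℤ) - 1) = 1) (hrn : r ^ n ≡ 1 [MOD m]) {d e : ℕ} (hd : d ∣ m)
    (he : e ∣ n) :
    {H : Subgroup G | IsCyclic H ∧ H.index = d * e}.ncard =
      if ((m / d : ℕ) : ℤ) ∣ (r : ℤ) ^ e - 1 then
        Int.gcd (d : ℤ) (((r : ℤ) ^ n - 1) / ((r : ℤ) ^ e - 1)) else 0 := by
  split_ifs with hr
  · rw [h.gcd_int_div_eq hmr hrn hd he hr, h.ncard_cyclic_index_eq hd he hr]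
  · convert! Set.ncard_empty (Subgroup G)
    rw [Set.eq_empty_iff_forall_notMem]
    rintro H ⟨hH, hi⟩
    obtain ⟨x, hx, hc, -⟩ := h.exists_lift hd he hH hi
    exact hr ((h.commute_lift_iff hd hx.1).1 hc)

theorem sum_cyclic_index (h : IsMetacyclicExt π a b m n r) [Finite G]
    {M : Type*} [NonAssocSemiring M] (F : ℕ → M) (s : Finset (Subgroup G))
    (hs : ∀ H, H ∈ s ↔ IsCyclic H) :
    ∑ H ∈ s, F H.index = ∑ d ∈ m.divisors, ∑ e ∈ n.divisors,
      ({H : Subgroup G | IsCyclic H ∧ H.index = d * e}.ncard : M) * F (d * e) := by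
  classical
  rw [← h.coprime.sum_divisors_mul_eq
    (fun D => ({H : Subgroup G | IsCyclic H ∧ H.index = D}.ncard : M) * F D),
    ← Finset.sum_fiberwise_of_maps_to (g := Subgroup.index) (t := (m * n).divisors)]
  · refine Finset.sum_congr rfl fun D _ => ?_
    rw [Finset.sum_congr rfl (g := fun _ => F D) (fun H hH => by rw [(Finset.mem_filter.1 hH).2]),
      Finset.sum_const, nsmul_eq_mul, ← Set.ncard_coe_finset]
    congr 3
    ext H
    simp [hs]
  · intro H _
    rw [Nat.mem_divisors, ← h.card_eq]
    exact ⟨H.index_dvd_card, Nat.card_pos.ne'⟩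

theorem CF₂_eq (h : IsMetacyclicExt π a b m n r)
    (hmr : Int.gcd (m : ℤ) ((r : ℤ) - 1) = 1) (hrn : r ^ n ≡ 1 [MOD m]) :
    CF₂ G =
        ∑ m₂ ∈ m.divisors, ∑ m₃ ∈ m.divisors with m₂.Coprime m₃,
          ∑ n₂ ∈ n.divisors, ∑ n₃ ∈ n.divisors with
            (n₂.Coprime n₃ ∧ ((m / m₂ : ℕ) : ℤ) ∣ (r : ℤ) ^ n₂ - 1 ∧
              ((m / m₃ : ℕ) : ℤ) ∣ (r : ℤ) ^ n₃ - 1),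
            Int.gcd (m₂ : ℤ) (((r : ℤ) ^ n - 1) / ((r : ℤ) ^ n₂ - 1)) *
              Int.gcd (m₃ : ℤ) (((r : ℤ) ^ n - 1) / ((r : ℤ) ^ n₃ - 1)) := by
  classical
  have := h.finite
  obtain ⟨s, hs⟩ : ∃ s : Finset (Subgroup G), ∀ H, H ∈ s ↔ IsCyclic H :=
    ⟨(Set.toFinite {H : Subgroup G | IsCyclic H}).toFinset, by simp⟩
  have h1 : CF₂ G = ∑ H ∈ s, ∑ K ∈ s, if H.index.Coprime K.index then 1 else 0 := by
    rw [← Finset.sum_product', ← Finset.card_filter, CF₂, ← Set.ncard_coe_finset]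
    congr 1
    ext ⟨H, K⟩
    simp [cyclicFactorizations, hs, h.mul_eq_univ_iff, and_assoc]
  rw [h1, h.sum_cyclic_index (fun D => ∑ K ∈ s, if D.Coprime K.index then 1 else 0) s hs]
  simp only [Nat.cast_id]
  refine Finset.sum_congr rfl fun d hd => ?_
  rw [Finset.sum_filter]
  simp_rw [Finset.sum_filter]
  have h2 : ∀ e ∈ n.divisors,
      (∑ K ∈ s, if (d * e).Coprime K.index then 1 else 0 : ℕ) =
        ∑ d' ∈ m.divisors, ∑ e' ∈ n.divisors,
          ({H : Subgroup G | IsCyclic H ∧ H.index = d' * e'}.ncard *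
            if (d * e).Coprime (d' * e') then 1 else 0) := fun e _ => by
    rw [h.sum_cyclic_index (fun D => if (d * e).Coprime D then 1 else 0) s hs]
    simp only [Nat.cast_id]
  rw [Finset.sum_congr rfl fun e he => by rw [h2 e he]]
  simp_rw [Finset.mul_sum]
  rw [Finset.sum_comm]
  refine Finset.sum_congr rfl fun d' hd' => ?_
  trans ∑ e ∈ n.divisors, ∑ e' ∈ n.divisors, if d.Coprime d' then
      if e.Coprime e' ∧ ((m / d : ℕ) : ℤ) ∣ (r : ℤ) ^ e - 1 ∧
          ((m / d' : ℕ) : ℤ) ∣ (r : ℤ) ^ e' - 1 then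
        Int.gcd (d : ℤ) (((r : ℤ) ^ n - 1) / ((r : ℤ) ^ e - 1)) *
          Int.gcd (d' : ℤ) (((r : ℤ) ^ n - 1) / ((r : ℤ) ^ e' - 1)) else 0 else 0
  swap
  · split_ifs <;> simp
  refine Finset.sum_congr rfl fun e he => Finset.sum_congr rfl fun e' he' => ?_
  rw [h.ncard_cyclic_index hmr hrn (Nat.dvd_of_mem_divisors hd) (Nat.dvd_of_mem_divisors he),
    h.ncard_cyclic_index hmr hrn (Nat.dvd_of_mem_divisors hd') (Nat.dvd_of_mem_divisors he')]
  simp only [Nat.coprime_mul_mul_iff_of_dvd h.coprime (Nat.dvd_of_mem_divisors hd)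
    (Nat.dvd_of_mem_divisors he) (Nat.dvd_of_mem_divisors hd') (Nat.dvd_of_mem_divisors he')]
  split_ifs <;> simp_all

end IsMetacyclicExt

/-! ### The presented group is such an extension. -/

section Presentation

variable {m n r : ℕ}

/-- The generators of `ZM m n r` as elements of that group. -/
abbrev ZM.of (m n r : ℕ) (g : ZMGenerator) : ZM m n r := PresentedGroup.of g

theorem ZM.a_pow : ZM.of m n r .a ^ m = 1 :=
  PresentedGroup.one_of_mem (rels := zmRelators m n r) (x := FreeGroup.of ZMGenerator.a ^ m)
    (by simp [zmRelators])

theorem ZM.b_pow : ZM.of m n r .b ^ n = 1 :=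
  PresentedGroup.one_of_mem (rels := zmRelators m n r) (x := FreeGroup.of ZMGenerator.b ^ n)
    (by simp [zmRelators])

theorem ZM.conj_a : (ZM.of m n r .b)⁻¹ * ZM.of m n r .a * ZM.of m n r .b = ZM.of m n r .a ^ r := by
  rw [← mul_inv_eq_one]
  exact PresentedGroup.one_of_mem (rels := zmRelators m n r)
    (x := (FreeGroup.of ZMGenerator.b)⁻¹ * FreeGroup.of ZMGenerator.a * FreeGroup.of ZMGenerator.b *
      (FreeGroup.of ZMGenerator.a ^ r)⁻¹) (by simp [zmRelators])

theorem ZM.exists_hom {H : Type*} [Group H] {x y : H} (hx : x ^ m = 1) (hy : y ^ n = 1)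
    (hxy : y⁻¹ * x * y = x ^ r) :
    ∃ f : ZM m n r →* H, f (ZM.of m n r .a) = x ∧ f (ZM.of m n r .b) = y := by
  let g : ZMGenerator → H := fun i => ZMGenerator.casesOn i x y
  have hg : ∀ w ∈ zmRelators m n r, FreeGroup.lift g w = 1 := by
    rintro w (rfl | rfl | rfl)
    · simpa [g] using hx
    · simpa [g] using hy
    · simpa [g, mul_inv_eq_one] using hxy
  exact ⟨PresentedGroup.toGroup hg, PresentedGroup.toGroup.of hg, PresentedGroup.toGroup.of hg⟩

/-- The relations could a priori collapse `a`. A model in the affine permutations of `ZMod m`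
excludes this: `a` acts as `x ↦ x + 1` and `b` as multiplication by `r⁻¹`. -/
theorem ZM.orderOf_a (hn : 0 < n) (hr : r ^ n ≡ 1 [MOD m]) : orderOf (ZM.of m n r .a) = m := by
  refine Nat.dvd_antisymm (orderOf_dvd_of_pow_eq_one ZM.a_pow) ?_
  have hr' : (r : ZMod m) ^ n = 1 := by
    have := (ZMod.natCast_eq_natCast_iff _ _ m).2 hr
    simpa using this
  have hpow (k : ℕ) : Equiv.addRight (1 : ZMod m) ^ k = Equiv.addRight (k : ZMod m) := by
    induction k with
    | zero => ext; simp
    | succ k ih => rw [pow_succ, ih]; ext; simp; ring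
  let u : (ZMod m)ˣ := Units.ofPowEqOne (r : ZMod m) n hr' hn.ne'
  have hu : u ^ n = 1 := Units.pow_ofPowEqOne hr' hn.ne'
  obtain ⟨f, hfa, -⟩ := ZM.exists_hom (m := m) (n := n) (r := r)
    (x := Equiv.addRight (1 : ZMod m)) (y := MulAction.toPermHom (ZMod m)ˣ (ZMod m) u⁻¹)
    (by rw [hpow]; ext; simp)
    (by rw [← map_pow, inv_pow, hu, inv_one, map_one])
    (by
      rw [hpow, ← map_inv, inv_inv]
      ext x
      have hur : u • (1 : ZMod m) = r := by simp [u, Units.smul_def]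
      simp [smul_add, hur])
  have h1 : f (ZM.of m n r .a) ^ orderOf (ZM.of m n r .a) = 1 := by
    rw [← map_pow, pow_orderOf_eq_one, map_one]
  rw [hfa, hpow] at h1
  have h2 := congrArg (fun σ : Equiv.Perm (ZMod m) => σ 0) h1
  simp only [Equiv.coe_addRight, zero_add, Equiv.Perm.coe_one, id] at h2
  exact (ZMod.natCast_eq_zero_iff _ _).1 h2

theorem ZM.zpowers_a_normal (hn : 0 < n) : (Subgroup.zpowers (ZM.of m n r .a)).Normal := by
  set N := Subgroup.zpowers (ZM.of m n r .a)
  set b := ZM.of m n r .b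
  have h1 : ∀ z ∈ N, b⁻¹ * z * b ∈ N := by
    rintro _ ⟨k, rfl⟩
    have h2 : (b⁻¹ * ZM.of m n r .a * b) ^ k = b⁻¹ * ZM.of m n r .a ^ k * b := by
      simpa using conj_zpow (a := b⁻¹) (b := ZM.of m n r .a) (i := k)
    simp only
    rw [← h2, ZM.conj_a]
    exact zpow_mem (pow_mem (Subgroup.mem_zpowers _) _) _
  have h2 : ∀ (j : ℕ), ∀ z ∈ N, (b ^ j)⁻¹ * z * b ^ j ∈ N := by
    intro j
    induction j with
    | zero => simp
    | succ j ih =>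
      intro z hz
      convert! h1 _ (ih z hz) using 1
      rw [pow_succ]
      group
  -- Since `b` has finite order, invariance under conjugation in one direction gives the other.
  have h3 : (b ^ (n - 1))⁻¹ = b := by
    rw [inv_eq_iff_mul_eq_one, ← pow_succ, Nat.sub_add_cancel hn]
    exact ZM.b_pow
  have h4 : b ^ (n - 1) = b⁻¹ := by rw [← h3, inv_inv, h3]
  rw [← Subgroup.normalizer_eq_top_iff, eq_top_iff]
  intro g _
  refine PresentedGroup.generated_by _ _ ?_ g
  rintro (_ | _)
  · exact Subgroup.le_normalizer (Subgroup.mem_zpowers _)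
  · rw [Subgroup.mem_normalizer_iff]
    intro z
    constructor
    · intro hz
      have := h2 (n - 1) z hz
      rwa [h3, h4] at this
    · intro hz
      have := h1 _ hz
      change b⁻¹ * (b * z * b⁻¹) * b ∈ N at this
      convert! this using 1
      group

theorem ZM.isMetacyclicExt (hm : 0 < m) (hn : 0 < n) (hmn : m.Coprime n)
    (hr : r ^ n ≡ 1 [MOD m]) :
    ∃ π : ZM m n r →* Multiplicative (ZMod n),
      IsMetacyclicExt π (ZM.of m n r .a) (ZM.of m n r .b) m n r := by
  obtain ⟨π, hπa, hπb⟩ := ZM.exists_hom (m := m) (n := n) (r := r)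
    (x := (1 : Multiplicative (ZMod n))) (y := Multiplicative.ofAdd 1)
    (one_pow m) (by rw [← ofAdd_nsmul]; simp) (by simp)
  have hord : orderOf (π (ZM.of m n r .b)) = n := by
    rw [hπb, orderOf_ofAdd_eq_addOrderOf, ZMod.addOrderOf_one]
  have hnormal := ZM.zpowers_a_normal (m := m) (r := r) hn
  have hgen : ∀ g, ∃ z ∈ Subgroup.zpowers (ZM.of m n r .a), ∃ k : ℤ,
      z * ZM.of m n r .b ^ k = g := by
    intro g
    have hg : g ∈ Subgroup.zpowers (ZM.of m n r .a) ⊔ Subgroup.zpowers (ZM.of m n r .b) := by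
      refine PresentedGroup.generated_by _ _ ?_ g
      rintro (_ | _)
      · exact Subgroup.mem_sup_left (Subgroup.mem_zpowers _)
      · exact Subgroup.mem_sup_right (Subgroup.mem_zpowers _)
    obtain ⟨z, hz, _, ⟨k, rfl⟩, hg⟩ := Subgroup.mem_sup_of_normal_left.1 hg
    exact ⟨z, hz, k, hg⟩
  have hle : Subgroup.zpowers (ZM.of m n r .a) ≤ π.ker := by
    rw [Subgroup.zpowers_le, MonoidHom.mem_ker, hπa]
  refine ⟨π, hm, hn, hmn, ZM.orderOf_a hn hr, ZM.b_pow, ZM.conj_a, ?_, hord, ?_⟩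
  · refine le_antisymm ?_ hle
    intro g hg
    obtain ⟨z, hz, k, rfl⟩ := hgen g
    have hz1 : π z = 1 := hle hz
    rw [MonoidHom.mem_ker, map_mul, hz1, one_mul, map_zpow, ← orderOf_dvd_iff_zpow_eq_one,
      hord] at hg
    obtain ⟨j, rfl⟩ := hg
    rwa [zpow_mul, zpow_natCast, ZM.b_pow, one_zpow, mul_one]
  · intro g
    obtain ⟨z, hz, k, rfl⟩ := hgen g
    have hz1 : π z = 1 := hle hz
    rw [map_mul, hz1, one_mul, map_zpow]
    exact zpow_mem (Subgroup.mem_zpowers _) k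

end Presentation

theorem theorem3p2 :
    (∀ m n r : ℕ, 0 < m → 0 < n →
      m.Coprime n → Int.gcd (m : ℤ) ((r : ℤ) - 1) = 1 → r ^ n ≡ 1 [MOD m] →
      CF₂ (ZM m n r) =
        ∑ m₂ ∈ m.divisors, ∑ m₃ ∈ m.divisors with m₂.Coprime m₃,
          ∑ n₂ ∈ n.divisors, ∑ n₃ ∈ n.divisors with
            (n₂.Coprime n₃ ∧ ((m / m₂ : ℕ) : ℤ) ∣ (r : ℤ) ^ n₂ - 1 ∧
              ((m / m₃ : ℕ) : ℤ) ∣ (r : ℤ) ^ n₃ - 1),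
            Int.gcd (m₂ : ℤ) (((r : ℤ) ^ n - 1) / ((r : ℤ) ^ n₂ - 1)) *
              Int.gcd (m₃ : ℤ) (((r : ℤ) ^ n - 1) / ((r : ℤ) ^ n₃ - 1))) ∧
    CF₂ (ZM 9 4 8) = 36 := by
  have main {m n r : ℕ} (hm : 0 < m) (hn : 0 < n) (hmn : m.Coprime n)
      (hmr : Int.gcd (m : ℤ) ((r : ℤ) - 1) = 1) (hr : r ^ n ≡ 1 [MOD m]) :=
    (ZM.isMetacyclicExt hm hn hmn hr).choose_spec.CF₂_eq hmr hr
  refine ⟨fun m n r => main, ?_⟩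
  rw [main (by decide) (by decide) (by decide) (by decide) (by decide)]
  decide +kernel
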